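/- **Setting.** Let $G=(V,E)$ be a finite simple undirected graph whose vertices are processes and whose edges are authenticated, reliable, asynchronous point-to-point channels. Let $V_t\subseteq V$ be the set of trusted nodes (known to all, always correct), let $f\in\mathbb N$, and suppose that at most $f$ nodes, all in $V\setminus V_t$, are Byzantine (they may send arbitrary messages to their neighbours at any time). No node uses signatures. **Protocol DolevU-T.** To broadcast a payload $m$ (each process broadcasts a given payload at most once), process $s$ sends $[m,\emptyset]$ to all its neighbours and delivers $m$. When a process $p_i$ receives $[m,\mathit{path}]$ from a neighbour $p_j$, it forms $\mathit{fwd}=\mathit{path}+[p_j]$, whose first node is the (claimed) broadcaster $s$; it stores, for the payload $m$ of $s$, the list of the untrusted nodes of $\mathit{fwd}$ other than its first entry $s$; and it sends $[m,\mathit{fwd}]$ to all its neighbours that are not among the untrusted nodes of $\mathit{fwd}$. A process that has not yet delivered the payload $m$ of $s$ delivers it once the lists stored for it contain the empty list or $f+1$ pairwise vertex-disjoint lists. **Reliable communication.** Two nodes $u,v$ *can communicate reliably using DolevU-T in $G$* if, for every set $B\subseteq V\setminus(V_t\cup\{u,v\})$ of at most $f$ Byzantine nodes, every (fair, asynchronous)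 execution, and all $s,i\in\{u,v\}$: $i$ delivers each payload of $s$ at most once (no duplication); if $i$ delivers a payload as coming from $s$ then $s$ broadcast it before (no creation); and if $s$ broadcasts a payload then $i$ eventually delivers it (validity). **Graphs.** Say that $x,y\in V$ are *linked* if $(x,y)\in E$ or there are trusted nodes $t_0,\dots,t_n\in V_t$ ($n\ge 0$) with $(x,t_0),(t_0,t_1),\dots,(t_{n-1},t_n),(t_n,y)\in E$. Let $f(G)$ be the graph with vertex set $V\setminus V_t$ in which two distinct nodes are adjacent iff they are linked. For a graph $G'$ with $V(G')\subseteq V$ and a node $w$, let $g(G,G',w)$ be the graph with vertex set $V(G')\cup\{w\}$ obtained from $G'$ by joining $w$ to every node $x\ne w$ of $G'$ that is linked to $w$. For a graph $H$, let $\Gamma_H(v)$ be the set of neighbours of $v$ in $H$, and let $\kappa_H(u,v)$ be the maximum number of distinct, pairwise internally vertex-disjoint paths from $u$ to $v$ in $H$. **Theorem.** Let $u_t\in V_t$ be a trusted node and $v\in V\setminus V_t$ an untrusted node. Then $u_t$ and $v$ can communicate reliably using DolevU-T in $G$ if and only if $$u_t\in\Gamma_{g(G,f(G),u_t)}(v)\quad\text{or}\quad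 \kappa_{g(G,f(G),u_t)}(u_t,v)\ge 2f+1 .$$ -/

import Mathlib

/-! ## The graphs `f(G)` and `g(G, G', w)`, and local vertex-connectivity -/

/-- A (simple, undirected) graph whose vertex set is a subset of `V`, with arbitrary edges between
its vertices. -/
abbrev GraphOn (V : Type*) := (⊤ : SimpleGraph V).Subgraph

/-- `x` and `y` are neighbours in `G`, or there are trusted nodes `t₀, …, tₙ` (at least one) with
`x — t₀ — ⋯ — tₙ — y` in `G`. -/
def TrustLinked {V : Type*} (G : SimpleGraph V) (Vt : Set V) (x y : V) : Prop :=
  G.Adj x y ∨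
    ∃ l : List V, l ≠ [] ∧ (∀ t ∈ l, t ∈ Vt) ∧ List.IsChain G.Adj (x :: (l ++ [y]))

theorem TrustLinked.symm {V : Type*} {G : SimpleGraph V} {Vt : Set V} {x y : V}
    (h : TrustLinked G Vt x y) : TrustLinked G Vt y x := by
  rcases h with h | ⟨l, hl, ht, hc⟩
  · exact Or.inl h.symm
  · refine Or.inr ⟨l.reverse, by simpa using hl, fun t h => ht t (by simpa using h), ?_⟩
    have h2 := List.isChain_reverse.2 (hc.imp fun a b (hab : G.Adj a b) => hab.symm)
    simpa using h2

/-- The graph `f(G)`: its vertices are the untrusted nodes, two of them being joined when they are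
neighbours in `G` or connected by a path of trusted nodes of `G`. -/
def untrustedGraph {V : Type*} (G : SimpleGraph V) (Vt : Set V) : GraphOn V where
  verts := {x | x ∉ Vt}
  Adj x y := x ≠ y ∧ x ∉ Vt ∧ y ∉ Vt ∧ TrustLinked G Vt x y
  adj_sub h := h.1
  edge_vert h := h.2.1
  symm := ⟨fun _ _ h => ⟨h.1.symm, h.2.2.1, h.2.1, h.2.2.2.symm⟩⟩

/-- The graph `g(G, G', w)`: the node `w` is added to `G'`, and joined to the nodes of `G'` that are
its neighbours in `G` or that are connected to it by a path of trusted nodes of `G`. -/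
def insertNode {V : Type*} (G : SimpleGraph V) (Vt : Set V) (G' : GraphOn V) (w : V) :
    GraphOn V where
  verts := insert w G'.verts
  Adj x y := G'.Adj x y ∨
    (x ∈ G'.verts ∧ y = w ∧ x ≠ w ∧ TrustLinked G Vt x w) ∨
    (y ∈ G'.verts ∧ x = w ∧ y ≠ w ∧ TrustLinked G Vt y w)
  adj_sub := by
    rintro x y (h | ⟨_, rfl, h, _⟩ | ⟨_, rfl, h, _⟩)
    · exact G'.adj_sub h
    · exact h
    · exact h.symm
  edge_vert := by
    rintro x y (h | ⟨h, _⟩ | ⟨_, h, _⟩)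
    · exact Or.inr (G'.edge_vert h)
    · exact Or.inr h
    · exact Or.inl h
  symm := ⟨by
    rintro x y (h | h | h)
    · exact Or.inl h.symm
    · exact Or.inr (Or.inr h)
    · exact Or.inr (Or.inl h)⟩

/-- `κ_H(u, v)`: the largest number of distinct paths from `u` to `v` in `H`, any two of which have
only `u` and `v` in common. (`H.spanningCoe` is `H` with the nodes of `V` outside `H` added as
isolated vertices; it has the same paths between two distinct nodes.) -/
noncomputable def vertexConnectivity {V : Type*} (H : GraphOn V) (u v : V) : ℕ∞ :=
  ⨆ (P : Finset (H.spanningCoe.Path u v))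
    (_ : ∀ p ∈ P, ∀ q ∈ P, p ≠ q →
      ∀ x ∈ p.1.support, x ∈ q.1.support → x = u ∨ x = v), (P.card : ℕ∞)

/-! ## The protocol DolevU-T -/

namespace DolevUT

/-- The message `[payload, path]` on the authenticated channel from `src` to `dst`. -/
structure Packet (V M : Type*) where
  src : V
  dst : V
  payload : M
  path : List V

/-- Local variables of a process. There is one instance of the protocol for each pair `(s, m)` of a
broadcaster `s` and a payload `m`. -/
structure LocalState (V M : Type*) where
  /-- the flag `delivered` of the instance `(s, m)` -/
  delivered : V → M → Prop
  /-- the set `paths` of the instance `(s, m)` -/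
  paths : V → M → Set (List V)

/-- State after the event `Init`. -/
def initState (V M : Type*) : LocalState V M where
  delivered _ _ := False
  paths _ _ := ∅

/-- Set the flag `delivered` of the instance `(s, m)`. -/
def LocalState.markDelivered {V M : Type*} (σ : LocalState V M) (s : V) (m : M) :
    LocalState V M where
  delivered s' m' := σ.delivered s' m' ∨ (s' = s ∧ m' = m)
  paths := σ.paths

/-- Insert `l` in the set `paths` of the instance `(s, m)`. -/
def LocalState.insertPath {V M : Type*} (σ : LocalState V M) (s : V) (m : M) (l : List V) :
    LocalState V M where
  delivered := σ.delivered
  paths s' m' := {l' | l' ∈ σ.paths s' m' ∨ (s' = s ∧ m' = m ∧ l' = l)}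

open Classical in
/-- `remove_all_trusted`. -/
noncomputable def removeTrusted {V : Type*} (Vt : Set V) (l : List V) : List V :=
  l.filter (fun x => decide (x ∉ Vt))

open Classical in
/-- Process `i` sends `[m, path]` to all its neighbours that are not in the list `excl`. -/
noncomputable def sendAll {V M : Type*} [Fintype V] (G : SimpleGraph V) (i : V) (excl : List V)
    (m : M) (path : List V) : Multiset (Packet V M) :=
  (Finset.univ.filter (fun k => G.Adj i k ∧ k ∉ excl)).val.map (fun k => ⟨i, k, m, path⟩)

/-- The broadcaster named by a received message `[m, path]` coming from the neighbour `j`: the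
first node of `path + [j]`. -/
def claimedSource {V : Type*} (path : List V) (j : V) : V := path.headD j

/-- State of process `i` after receiving `[m, path]` from its neighbour `j`: the nodes of
`path + [j]` other than the initial broadcaster, without the trusted ones, are stored. -/
noncomputable def receiveState {V M : Type*} (Vt : Set V) (σ : LocalState V M) (j : V) (m : M)
    (path : List V) : LocalState V M :=
  σ.insertPath (claimedSource path j) m (removeTrusted Vt (path ++ [j]).tail)

/-- Messages sent by process `i` when it receives `[m, path]` from its neighbour `j`: the augmented
path is sent, trusted nodes included, to the neighbours of `i` that are not among its untrusted
nodes. -/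
noncomputable def receiveSends {V M : Type*} [Fintype V] (G : SimpleGraph V) (Vt : Set V) (i j : V)
    (m : M) (path : List V) : Multiset (Packet V M) :=
  sendAll G i (removeTrusted Vt (path ++ [j])) m (path ++ [j])

/-- The condition under which a process delivers the payload `m` of `s`: it has not delivered it,
and `paths` contains the empty path or `f + 1` vertex-disjoint paths. -/
def CanDeliver {V M : Type*} (f : ℕ) (σ : LocalState V M) (s : V) (m : M) : Prop :=
  ¬ σ.delivered s m ∧
    ([] ∈ σ.paths s m ∨
      ∃ S : Finset (List V), (S : Set (List V)) ⊆ σ.paths s m ∧ S.card = f + 1 ∧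
        ∀ l ∈ S, ∀ l' ∈ S, l ≠ l' → List.Disjoint l l')

/-! ## Executions -/

/-- The local states of the processes (meaningless for the Byzantine ones) and the messages in
transit. -/
structure Config (V M : Type*) where
  state : V → LocalState V M
  net : Multiset (Packet V M)

inductive Event (V M : Type*) where
  /-- process `i` RC-broadcasts `m` -/
  | broadcast (i : V) (m : M)
  /-- the message is handed over to its destination -/
  | receive (p : Packet V M)
  /-- process `i` RC-delivers the payload `m` of the broadcaster `s` -/
  | deliver (i s : V) (m : M)
  /-- a Byzantine process sends an arbitrary message to a neighbour -/
  | faultySend (p : Packet V M)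
  /-- nothing happens -/
  | idle

open Classical in
/-- One step of the asynchronous system, where `B` is the set of Byzantine processes. -/
inductive Step {V M : Type*} [Fintype V] (G : SimpleGraph V) (Vt : Set V) (f : ℕ) (B : Finset V) :
    Config V M → Event V M → Config V M → Prop
  | broadcast (c : Config V M) (i : V) (m : M) (hi : i ∉ B) :
      Step G Vt f B c (.broadcast i m)
        ⟨Function.update c.state i ((c.state i).markDelivered i m), c.net + sendAll G i [] m []⟩
  | receive (c : Config V M) (p : Packet V M) (net' : Multiset (Packet V M))
      (hp : p.dst ∉ B) (hnet : c.net = p ::ₘ net') :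
      Step G Vt f B c (.receive p)
        ⟨Function.update c.state p.dst (receiveState Vt (c.state p.dst) p.src p.payload p.path),
          net' + receiveSends G Vt p.dst p.src p.payload p.path⟩
  | faultyReceive (c : Config V M) (p : Packet V M) (net' : Multiset (Packet V M))
      (hp : p.dst ∈ B) (hnet : c.net = p ::ₘ net') :
      Step G Vt f B c (.receive p) ⟨c.state, net'⟩
  | deliver (c : Config V M) (i s : V) (m : M) (hi : i ∉ B) (h : CanDeliver f (c.state i) s m) :
      Step G Vt f B c (.deliver i s m)
        ⟨Function.update c.state i ((c.state i).markDelivered s m), c.net⟩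
  | faultySend (c : Config V M) (p : Packet V M) (hp : p.src ∈ B) (hadj : G.Adj p.src p.dst) :
      Step G Vt f B c (.faultySend p) ⟨c.state, p ::ₘ c.net⟩
  | idle (c : Config V M) : Step G Vt f B c .idle c

/-- A fair infinite execution of DolevU-T on `G` with set `B` of Byzantine processes. -/
structure Execution {V : Type*} (M : Type*) [Fintype V] (G : SimpleGraph V) (Vt : Set V) (f : ℕ)
    (B : Finset V) where
  config : ℕ → Config V M
  event : ℕ → Event V M
  init : config 0 = ⟨fun _ => initState V M, 0⟩
  step : ∀ n, Step G Vt f B (config n) (event n) (config (n + 1))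
  /-- a correct process broadcasts a given payload at most once -/
  broadcast_once : ∀ n k i m, event n = .broadcast i m → event k = .broadcast i m → n = k
  /-- channels are reliable: a message in transit to a correct process is eventually received -/
  fair_net : ∀ n, ∀ p ∈ (config n).net, p.dst ∉ B → ∃ k, n ≤ k ∧ event k = .receive p
  /-- a correct process that is able to deliver eventually does -/
  fair_deliver : ∀ n i s m, i ∉ B → CanDeliver f ((config n).state i) s m →
    ∃ k, n ≤ k ∧ ((config k).state i).delivered s m

/-- Process `i` RC-delivers the payload `m` of the broadcaster `s` at time `n`. A broadcaster
delivers its own payload when it broadcasts it. -/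
def Execution.DeliversAt {V M : Type*} [Fintype V] {G : SimpleGraph V} {Vt : Set V} {f : ℕ}
    {B : Finset V} (e : Execution M G Vt f B) (n : ℕ) (i s : V) (m : M) : Prop :=
  e.event n = .deliver i s m ∨ (i = s ∧ e.event n = .broadcast i m)

/-- The properties of reliable communication for the payloads that `s` broadcasts and `i`
delivers. -/
structure Execution.Reliable {V M : Type*} [Fintype V] {G : SimpleGraph V} {Vt : Set V} {f : ℕ}
    {B : Finset V} (e : Execution M G Vt f B) (s i : V) : Prop where
  no_duplication : ∀ m n k, e.DeliversAt n i s m → e.DeliversAt k i s m → n = k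
  no_creation : ∀ m n, e.DeliversAt n i s m → ∃ k, k ≤ n ∧ e.event k = .broadcast s m
  validity : ∀ m n, e.event n = .broadcast s m → ∃ k, n ≤ k ∧ e.DeliversAt k i s m

/-- `u` and `v` can communicate reliably using DolevU-T in `G`: whichever at most `f` untrusted
nodes other than `u` and `v` are Byzantine, the properties of reliable communication hold between
`u` and `v`, in both directions, in all executions. -/
def CommunicateReliably {V : Type*} (M : Type*) [Fintype V] (G : SimpleGraph V) (Vt : Set V)
    (f : ℕ) (u v : V) : Prop :=
  ∀ B : Finset V, (∀ b ∈ B, b ∉ Vt) → B.card ≤ f → u ∉ B → v ∉ B →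
    ∀ e : Execution M G Vt f B,
      ∀ s i : V, (s = u ∨ s = v) → (i = u ∨ i = v) → e.Reliable s i

end DolevUT

/-! Both directions rest on one count, `not_canDeliver`: if all lists stored for a payload meet a
set `C` of at most `f` nodes, then none of them is empty and no `f + 1` of them are disjoint, so
nothing is delivered.

Safety needs no connectivity. Take `C = B`: since channels are authenticated, a message forged in
the name of a correct `s` carries its Byzantine sender behind the claimed source, and this untrusted
node stays in every list derived from it (`Execution.paths_forged`).

Sufficiency: an edge of `g(G, f(G), u)` is realised in `G` by trusted nodes, which are correct and
vanish from the stored lists. A path of `g(G, f(G), u)` avoiding `B` therefore gets its inner nodes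
stored as a list at the destination. An edge gives the empty list; among `2 f + 1` disjoint paths,
`B` meets at most `f`, and `f + 1` disjoint lists remain.

Necessity: otherwise Menger's theorem, derived here from Hall's marriage theorem, yields at most `2
f` separating nodes in `g(G, f(G), u)`, and from them a set `X` of at most `2 f` untrusted nodes
separating `u` from `v` in `G`. Let `B` be about half of `X`, and silent: every list that `v` stores
meets `C = X \ B`, so `v` never delivers and validity fails in a fair execution. -/

namespace SimpleGraph

/-! ### Menger's theorem from Hall's marriage theorem -/

/-- Following an injective successor function on the inner nodes together with `k` extra elements,
which stand for the first end of an edge at `u` and for the second end of an edge at `v`. -/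
theorem exists_walk_of_iterate {V ι : Type*} (H : SimpleGraph V) {u v : V}
    (σ : {x // x ≠ u ∧ x ≠ v} ⊕ ι → {x // x ≠ u ∧ x ≠ v} ⊕ ι)
    (hσ : ∀ a, (∃ x, a = .inl x ∧ σ a = .inl x) ∨
      H.Adj (Sum.elim Subtype.val (fun _ => u) a) (Sum.elim Subtype.val (fun _ => v) (σ a)))
    (i : ι) (n : ℕ) (hn : ∀ j, 0 < j → j ≤ n → (σ^[j] (.inr i)).isLeft)
    (b : {x // x ≠ u ∧ x ≠ v} ⊕ ι) (hb : σ^[n + 1] (.inr i) = b) :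
    ∃ w : H.Walk u (Sum.elim Subtype.val (fun _ => v) b),
      ∀ x ∈ w.support, x = u ∨
        ∃ j, 0 < j ∧ j ≤ n + 1 ∧ Sum.elim Subtype.val (fun _ => v) (σ^[j] (.inr i)) = x := by
  induction n generalizing b with
  | zero =>
    subst hb
    rcases hσ (.inr i) with ⟨x, h, _⟩ | h
    · cases h
    · refine ⟨Walk.cons h Walk.nil, fun x hx => ?_⟩
      replace hx : x ∈ [u, Sum.elim Subtype.val (fun _ => v) (σ (.inr i))] := hx
      rw [List.mem_cons, List.mem_singleton] at hx
      rcases hx with rfl | rfl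
      · exact Or.inl rfl
      · exact Or.inr ⟨1, by simp, by simp, rfl⟩
  | succ n ih =>
    obtain ⟨y, hy⟩ := Sum.isLeft_iff.1 (hn (n + 1) (by omega) le_rfl)
    obtain ⟨w, hw⟩ := ih (fun j h0 hj => hn j h0 (by omega)) _ hy
    have hlast : σ (.inl y) = b := by
      rw [← hy, ← hb]
      exact (Function.iterate_succ_apply' σ (n + 1) _).symm
    have hstep := hσ (.inl y)
    rw [hlast] at hstep
    rcases hstep with ⟨x, h, rfl⟩ | h
    · cases h
      exact ⟨w, fun x hx => (hw x hx).imp_right fun ⟨j, h0, hj, e⟩ => ⟨j, h0, by omega, e⟩⟩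
    · refine ⟨w.concat h, fun x hx => ?_⟩
      replace hx : x ∈ w.support ++ [_] := (congrArg (x ∈ ·) (Walk.support_concat w h)).mp hx
      rw [List.mem_append, List.mem_singleton] at hx
      rcases hx with hx | rfl
      · exact (hw x hx).imp_right fun ⟨j, h0, hj, e⟩ => ⟨j, h0, by omega, e⟩
      · exact Or.inr ⟨n + 2, by omega, le_rfl, by rw [hb]⟩

/-- Such a successor function yields a system of internally disjoint paths. -/
theorem exists_disjoint_paths_of_injective {V : Type*} [Fintype V] (H : SimpleGraph V) {u v : V} (k : ℕ)
    (σ : {x // x ≠ u ∧ x ≠ v} ⊕ Fin k → {x // x ≠ u ∧ x ≠ v} ⊕ Fin k)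
    (hinj : Function.Injective σ)
    (hσ : ∀ a, (∃ x, a = .inl x ∧ σ a = .inl x) ∨
      H.Adj (Sum.elim Subtype.val (fun _ => u) a) (Sum.elim Subtype.val (fun _ => v) (σ a))) :
    ∃ p : Fin k → H.Path u v, ∀ i j, i ≠ j →
      ∀ x ∈ (p i).1.support, x ∈ (p j).1.support → x = u ∨ x = v := by
  classical
  have hpath : ∀ i : Fin k, ∃ p : H.Path u v, ∀ x ∈ p.1.support, x = u ∨ x = v ∨
      ∃ (j : ℕ) (hx : x ≠ u ∧ x ≠ v), σ^[j] (.inr i) = .inl ⟨x, hx⟩ ∧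
        ∀ j', 0 < j' → j' ≤ j → (σ^[j'] (.inr i)).isLeft := by
    -- An injective self-map of a finite type brings `.inr i` back to itself, so the orbit meets the
    -- right summand at a positive time. Up to the first such time it runs through inner nodes, and
    -- there it reaches `v`.
    intro i
    have hex : ∃ n, (σ^[n + 1] (.inr i)).isRight := by
      obtain ⟨n, hn, hp⟩ := hinj.mem_periodicPts (.inr i)
      refine ⟨n - 1, ?_⟩
      rw [Nat.sub_add_cancel hn, hp.eq]
      rfl
    have hleft : ∀ j, 0 < j → j ≤ Nat.find hex → (σ^[j] (.inr i)).isLeft := by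
      intro j h0 hj
      have := Nat.find_min hex (m := j - 1) (by omega)
      rw [Nat.sub_add_cancel h0] at this
      simpa using this
    obtain ⟨y, hy⟩ := Sum.isRight_iff.1 (Nat.find_spec hex)
    obtain ⟨w, hw⟩ := exists_walk_of_iterate H σ hσ i (Nat.find hex) hleft _ hy
    refine ⟨w.toPath, fun x hx => ?_⟩
    by_cases hxu : x = u
    · exact Or.inl hxu
    by_cases hxv : x = v
    · exact Or.inr (Or.inl hxv)
    obtain h | ⟨j, h0, hj, e⟩ := hw x (Walk.support_bypass_subset_support w hx)
    · exact absurd h hxu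
    refine Or.inr (Or.inr ⟨j, ⟨hxu, hxv⟩, ?_, fun j' h0' hj' => hleft j' h0' ?_⟩)
    · rcases h : σ^[j] (.inr i) with z | z
      · rw [h] at e
        exact congrArg Sum.inl (Subtype.ext e)
      · rw [h] at e
        exact absurd e.symm hxv
    · have : j ≠ Nat.find hex + 1 := by
        rintro rfl
        rw [hy] at e
        exact hxv e.symm
      omega
  choose p hp using hpath
  refine ⟨p, fun i j hij x hxi hxj => ?_⟩
  by_contra hx
  rw [not_or] at hx
  obtain h | h | ⟨a, ha, hai, hal⟩ := hp i x hxi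
  · exact hx.1 h
  · exact hx.2 h
  obtain h | h | ⟨b, hb, hbj, hbl⟩ := hp j x hxj
  · exact hx.1 h
  · exact hx.2 h
  -- If two orbits meet, cancelling `a` steps gives `.inr i = σ^[b - a] (.inr j)`: either `i = j`,
  -- or the orbit of `j` was back in the right summand by time `b`.
  have key : ∀ (i j : Fin k) (a b : ℕ), i ≠ j → a ≤ b → σ^[a] (.inr i) = σ^[b] (.inr j) →
      ¬ ∀ j', 0 < j' → j' ≤ b → (σ^[j'] (.inr j)).isLeft := by
    intro i j a b hij hab h hl
    rw [← Nat.add_sub_of_le hab, Function.iterate_add_apply] at h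
    have h' := hinj.iterate a h
    rcases Nat.eq_zero_or_pos (b - a) with h0 | h0
    · rw [h0] at h'
      exact hij (Sum.inr_injective h')
    · have := hl (b - a) h0 (by omega)
      rw [← h'] at this
      cases this
  rcases le_total a b with hab | hab
  · exact key i j a b hij hab (hai.trans hbj.symm) hbl
  · exact key j i b a hij.symm hab (hbj.trans hai.symm) hal

/-- **Menger's theorem** for two nodes that are not neighbours: there are `k` internally disjoint
paths, or fewer than `k` nodes separate the two nodes. -/
theorem exists_disjoint_paths_or_separator {V : Type*} [Fintype V] (H : SimpleGraph V) {u v : V}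
    (huv : u ≠ v) (hadj : ¬ H.Adj u v) (k : ℕ) :
    (∃ P : Finset (H.Path u v), P.card = k ∧ ∀ p ∈ P, ∀ q ∈ P, p ≠ q →
      ∀ x ∈ p.1.support, x ∈ q.1.support → x = u ∨ x = v) ∨
    ∃ (R : Set V) (X : Finset V), X.card < k ∧ u ∈ R ∧ v ∉ R ∧ v ∉ X ∧
      ∀ x ∈ R, ∀ y, H.Adj x y → y ∈ R ∨ y ∈ X := by
  classical
  -- A matching for `r` is a successor function: nodes off the paths can be matched to themselves,
  -- and the `k` extra elements act as `u` on the left and as `v` on the right.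
  let r : {x // x ≠ u ∧ x ≠ v} ⊕ Fin k → {x // x ≠ u ∧ x ≠ v} ⊕ Fin k → Prop := fun a b =>
    (∃ x, a = .inl x ∧ b = .inl x) ∨
      H.Adj (Sum.elim Subtype.val (fun _ => u) a) (Sum.elim Subtype.val (fun _ => v) b)
  by_cases hall : ∀ A : Finset ({x // x ≠ u ∧ x ≠ v} ⊕ Fin k),
      A.card ≤ (Finset.univ.filter fun b => ∃ a ∈ A, r a b).card
  · left
    obtain ⟨σ, hinj, hσ⟩ := (Fintype.all_card_le_filter_rel_iff_exists_injective r).1 hall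
    obtain ⟨p, hp⟩ := exists_disjoint_paths_of_injective H k σ hinj hσ
    -- If two indices gave the same path, its second node would be `u` or `v`; the former would be a
    -- loop, the latter the excluded edge.
    have hpinj : Function.Injective p := by
      intro i j hij
      by_contra hne
      have hnil : ¬ (p i).1.Nil := Walk.not_nil_of_ne huv
      have hs := (p i).1.adj_snd hnil
      have hmem : (p i).1.snd ∈ (p i).1.support := (p i).1.getVert_mem_support 1
      rcases hp i j hne _ hmem (hij ▸ hmem) with h | h
      · rw [h] at hs
        exact hs.ne rfl
      · rw [h] at hs
        exact hadj hs
    refine ⟨Finset.univ.map ⟨p, hpinj⟩, by simp, fun a ha b hb hab => ?_⟩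
    obtain ⟨i, -, rfl⟩ := Finset.mem_map.1 ha
    obtain ⟨j, -, rfl⟩ := Finset.mem_map.1 hb
    exact hp i j fun h => hab (h ▸ rfl)
  · right
    push Not at hall
    obtain ⟨A, hA⟩ := hall
    set N := Finset.univ.filter fun b => ∃ a ∈ A, r a b with hN
    have hmemN : ∀ b, b ∈ N ↔ ∃ a ∈ A, r a b := fun b => by simp [hN]
    have hsub : A.toLeft ⊆ N.toLeft := fun x hx => by
      rw [Finset.mem_toLeft] at hx ⊢
      exact (hmemN _).2 ⟨_, hx, Or.inl ⟨x, rfl, rfl⟩⟩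
    have hcA : A.toLeft.card + A.toRight.card = A.card := Finset.card_toLeft_add_card_toRight
    have hcN : N.toLeft.card + N.toRight.card = N.card := Finset.card_toLeft_add_card_toRight
    have hle := Finset.card_le_card hsub
    have hk : A.toRight.card ≤ k := by simpa using Finset.card_le_univ A.toRight
    have hsd := Finset.card_sdiff_of_subset hsub
    -- Since `N` contains the left part of `A`, a violation of Hall's condition forces a copy of `u`
    -- into `A`; so all inner neighbours of `u` lie in `N`.
    obtain ⟨i, hi⟩ : A.toRight.Nonempty := Finset.card_pos.1 (by omega)
    rw [Finset.mem_toRight] at hi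
    -- A neighbour of `v` in `A` would put all `k` copies of `v` into `N`, making `N` at least as
    -- large as `A`.
    have hvR : ∀ x, Sum.inl x ∈ A → ¬ H.Adj x.1 v := by
      intro x hx hxv
      have : N.toRight = Finset.univ := by
        refine Finset.eq_univ_iff_forall.2 fun j => ?_
        rw [Finset.mem_toRight]
        exact (hmemN _).2 ⟨_, hx, Or.inr hxv⟩
      rw [this, Finset.card_univ, Fintype.card_fin] at hcN
      omega
    -- The separator is the set of inner nodes of `N` outside `A`; its size is less than the number
    -- of copies of `u` in `A`, hence less than `k`.
    refine ⟨{x | x = u ∨ ∃ h, Sum.inl ⟨x, h⟩ ∈ A},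
      (N.toLeft \ A.toLeft).map ⟨Subtype.val, Subtype.val_injective⟩, ?_, Or.inl rfl, ?_, ?_, ?_⟩
    · rw [Finset.card_map]
      omega
    · rintro (h | ⟨h, _⟩)
      · exact huv h.symm
      · exact h.2 rfl
    · simp
    · intro x hx y hxy
      by_cases hyu : y = u
      · exact Or.inl (Or.inl hyu)
      have hyv : y ≠ v := by
        rintro rfl
        rcases hx with rfl | ⟨h, hx⟩
        · exact hadj hxy
        · exact hvR _ hx hxy
      by_cases hyA : Sum.inl ⟨y, hyu, hyv⟩ ∈ A
      · exact Or.inl (Or.inr ⟨_, hyA⟩)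
      refine Or.inr (Finset.mem_map.2 ⟨⟨y, hyu, hyv⟩, ?_, rfl⟩)
      rw [Finset.mem_sdiff, Finset.mem_toLeft, Finset.mem_toLeft]
      refine ⟨(hmemN _).2 ?_, hyA⟩
      rcases hx with rfl | ⟨h, hx⟩
      · exact ⟨_, hi, Or.inr hxy⟩
      · exact ⟨_, hx, Or.inr hxy⟩

end SimpleGraph

/-! ### Paths and separators of `g(G, f(G), u)` in terms of `G` -/

/-- The nodes of `l` form a path of untrusted nodes from `s` to `i`, consecutive ones being
neighbours or connected by trusted nodes. -/
structure LinkedVia {V : Type*} (G : SimpleGraph V) (Vt : Set V) (s i : V) (l : List V) :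
    Prop where
  chain : List.IsChain (TrustLinked G Vt) (s :: (l ++ [i]))
  nodup : (s :: (l ++ [i])).Nodup
  untrusted : ∀ x ∈ l, x ∉ Vt

theorem LinkedVia.reverse {V : Type*} {G : SimpleGraph V} {Vt : Set V} {s i : V} {l : List V}
    (h : LinkedVia G Vt s i l) : LinkedVia G Vt i s l.reverse where
  chain := by
    have := List.isChain_reverse.2 (h.chain.imp fun a b hab => TrustLinked.symm hab)
    simpa using this
  nodup := by
    have := List.nodup_reverse.2 h.nodup
    simpa using this
  untrusted x hx := h.untrusted x (List.mem_reverse.1 hx)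

theorem insertNode_adj_trustLinked {V : Type*} {G : SimpleGraph V} {Vt : Set V} {w x y : V}
    (h : (insertNode G Vt (untrustedGraph G Vt) w).Adj x y) : TrustLinked G Vt x y := by
  rcases h with h | ⟨_, rfl, _, h⟩ | ⟨_, rfl, _, h⟩
  · exact h.2.2.2
  · exact h
  · exact h.symm

theorem insertNode_adj_of_trustLinked {V : Type*} {G : SimpleGraph V} {Vt : Set V} {w x y : V}
    (hx : x = w ∨ x ∉ Vt) (hy : y ∉ Vt) (hxy : x ≠ y) (h : TrustLinked G Vt x y) :
    (insertNode G Vt (untrustedGraph G Vt) w).Adj x y := by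
  by_cases hxw : x = w
  · subst hxw
    exact Or.inr (Or.inr ⟨hy, rfl, hxy.symm, h.symm⟩)
  · exact Or.inl ⟨hxy, hx.resolve_left hxw, hy, h⟩

theorem mem_verts_of_isChain_adj {V : Type*} (H : GraphOn V) {a : V} {l : List V}
    (h : List.IsChain H.Adj (a :: l)) : ∀ x ∈ l, x ∈ H.verts := by
  induction l generalizing a with
  | nil => simp
  | cons b l ih =>
    rw [List.isChain_cons_cons] at h
    intro x hx
    rcases List.mem_cons.1 hx with rfl | hx
    · exact H.edge_vert h.1.symm
    · exact ih h.2 x hx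

/-- The only vertex of `g(G, f(G), u)` that may be trusted is `u`, which a path does not revisit;
hence the inner nodes are untrusted. -/
theorem exists_linkedVia_of_path {V : Type*} (G : SimpleGraph V) (Vt : Set V) {u v : V}
    (huv : u ≠ v) (p : (insertNode G Vt (untrustedGraph G Vt) u).spanningCoe.Path u v) :
    ∃ l, p.1.support = u :: (l ++ [v]) ∧ LinkedVia G Vt u v l := by
  obtain ⟨l, hl⟩ : ∃ l, p.1.support = u :: (l ++ [v]) := by
    obtain ⟨w, hw⟩ := p
    cases w with
    | nil => exact absurd rfl huv
    | cons h w =>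
      refine ⟨w.support.dropLast, ?_⟩
      rw [SimpleGraph.Walk.support_cons]
      congr 1
      conv_lhs => rw [← List.dropLast_append_getLast w.support_ne_nil]
      rw [SimpleGraph.Walk.getLast_support]
  have hchain := p.1.isChain_adj_support
  have hnodup := p.2.support_nodup
  rw [hl] at hchain hnodup
  replace hchain : List.IsChain (insertNode G Vt (untrustedGraph G Vt) u).Adj (u :: (l ++ [v])) :=
    hchain.imp fun a b h => h
  refine ⟨l, hl, hchain.imp fun a b h => insertNode_adj_trustLinked h, hnodup, fun x hx => ?_⟩
  have hx' := mem_verts_of_isChain_adj _ hchain x (List.mem_append_left _ hx)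
  refine hx'.resolve_left ?_
  rintro rfl
  exact (List.nodup_cons.1 hnodup).1 (List.mem_append_left _ hx)

theorem exists_disjoint_linkedVia {V : Type*} (G : SimpleGraph V) (Vt : Set V) {u v : V}
    (huv : u ≠ v) {n : ℕ}
    (h : ((n + 1 : ℕ) : ℕ∞) ≤
      vertexConnectivity (insertNode G Vt (untrustedGraph G Vt) u) u v) :
    ∃ L : Finset (List V), n < L.card ∧ (∀ l ∈ L, LinkedVia G Vt u v l) ∧
      ∀ l ∈ L, ∀ l' ∈ L, l ≠ l' → List.Disjoint l l' := by
  classical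
  have hlt : (n : ℕ∞) < vertexConnectivity (insertNode G Vt (untrustedGraph G Vt) u) u v :=
    lt_of_lt_of_le (by exact_mod_cast n.lt_succ_self) h
  simp only [vertexConnectivity, lt_iSup_iff] at hlt
  obtain ⟨P, hP, hcard⟩ := hlt
  choose r hr hrl using exists_linkedVia_of_path G Vt huv
  have hinj : Function.Injective r := fun p q hpq =>
    Subtype.ext (SimpleGraph.Walk.ext_support (by rw [hr, hr, hpq]))
  refine ⟨P.map ⟨r, hinj⟩, by rw [Finset.card_map]; exact_mod_cast hcard, ?_, ?_⟩
  · intro l hl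
    obtain ⟨p, -, rfl⟩ := Finset.mem_map.1 hl
    exact hrl p
  · intro l hl l' hl' hne x hx hx'
    obtain ⟨p, hp, rfl⟩ := Finset.mem_map.1 hl
    obtain ⟨q, hq, rfl⟩ := Finset.mem_map.1 hl'
    replace hx : x ∈ r p := hx
    replace hx' : x ∈ r q := hx'
    have hn := (hrl p).nodup
    rcases hP p hp q hq (fun h => hne (h ▸ rfl)) x (by simp [hr, hx]) (by simp [hr, hx'])
      with rfl | rfl
    · simp [hx] at hn
    · exact (List.nodup_append.1 (List.nodup_cons.1 hn).2).2.2 x hx x (by simp) rfl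

/-- When `u` and `v` are not adjacent in `g(G, f(G), u)` and at most `n` disjoint paths join them
there, at most `n` untrusted nodes of `G` separate `u` from `v`. -/
theorem exists_untrusted_separator {V : Type*} [Fintype V] (G : SimpleGraph V) (Vt : Set V)
    {u v : V} (hu : u ∈ Vt) (hv : v ∉ Vt) {n : ℕ}
    (hadj : ¬ (insertNode G Vt (untrustedGraph G Vt) u).Adj u v)
    (h : ¬ ((n + 1 : ℕ) : ℕ∞) ≤
      vertexConnectivity (insertNode G Vt (untrustedGraph G Vt) u) u v) :
    ∃ (D : Set V) (X : Finset V), X.card ≤ n ∧ (∀ x ∈ X, x ∉ Vt) ∧ u ∈ D ∧ v ∉ D ∧ v ∉ X ∧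
      ∀ x ∈ D, ∀ y, G.Adj x y → y ∈ D ∨ y ∈ X := by
  classical
  have huv : u ≠ v := by
    rintro rfl
    exact hv hu
  obtain ⟨P, hcard, hP⟩ | ⟨R, X, hcard, huR, hvR, hvX, hsep⟩ :=
    SimpleGraph.exists_disjoint_paths_or_separator
      (insertNode G Vt (untrustedGraph G Vt) u).spanningCoe huv hadj (n + 1)
  · exact absurd (hcard ▸ le_iSup₂_of_le P hP le_rfl) h
  -- `D` fills the trusted nodes back in: it has `u`, the untrusted nodes of `R`, and the trusted
  -- nodes linked to one of these.
  let D : Set V := {y | y ∈ R ∧ (y = u ∨ y ∉ Vt) ∨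
    y ∈ Vt ∧ ∃ x ∈ R, (x = u ∨ x ∉ Vt) ∧ TrustLinked G Vt x y}
  have key : ∀ x ∈ R, (x = u ∨ x ∉ Vt) → ∀ y, TrustLinked G Vt x y →
      y ∈ D ∨ y ∈ X.filter (· ∉ Vt) := by
    intro x hx hxu y hxy
    by_cases hy : y ∈ Vt
    · exact Or.inl (Or.inr ⟨hy, x, hx, hxu, hxy⟩)
    -- A node can be linked to itself through trusted nodes, whereas `g(G, f(G), u)` has no loops.
    by_cases hne : x = y
    · exact Or.inl (Or.inl ⟨hne ▸ hx, Or.inr hy⟩)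
    rcases hsep x hx y (insertNode_adj_of_trustLinked hxu hy hne hxy) with h | h
    · exact Or.inl (Or.inl ⟨h, Or.inr hy⟩)
    · exact Or.inr (Finset.mem_filter.2 ⟨h, hy⟩)
  refine ⟨D, X.filter (· ∉ Vt), ?_, ?_, Or.inl ⟨huR, Or.inl rfl⟩, ?_, ?_, ?_⟩
  rotate_left 4
  · rintro x (⟨hx, hxu⟩ | ⟨hx, z, hz, hzu, hzx⟩) y hxy
    · exact key x hx hxu y (Or.inl hxy)
    · refine key z hz hzu y (Or.inr ?_)
      rcases hzx with hzx | ⟨l, hl, ht, hc⟩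
      · exact ⟨[x], by simp, by simpa using hx, by simp [hzx, hxy]⟩
      · refine ⟨l ++ [x], by simp, ?_, ?_⟩
        · intro t ht'
          rcases List.mem_append.1 ht' with h | h
          · exact ht t h
          · rw [List.mem_singleton.1 h]
            exact hx
        · have : List.IsChain G.Adj ((z :: (l ++ [x])) ++ [y]) :=
            hc.append (List.isChain_singleton _) (by
              intro a ha b hb
              rw [← List.cons_append, List.getLast?_concat, Option.mem_some] at ha
              rw [List.head?_cons, Option.mem_some] at hb
              rwa [← ha, ← hb])
          simpa using this
  · exact (Finset.card_filter_le _ _).trans (by omega)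
  · exact fun x hx => (Finset.mem_filter.1 hx).2
  · rintro (⟨h, _⟩ | ⟨h, _⟩)
    · exact hvR h
    · exact hv h
  · exact fun h => hvX (Finset.mem_filter.1 h).1

/-! ### Stored lists and the delivery condition -/

namespace DolevUT

variable {V M : Type*} {G : SimpleGraph V} {Vt : Set V} {f : ℕ} {B : Finset V}

theorem mem_removeTrusted {x : V} {l : List V} : x ∈ removeTrusted Vt l ↔ x ∈ l ∧ x ∉ Vt := by
  classical
  simp [removeTrusted]

theorem removeTrusted_append (l l' : List V) :
    removeTrusted Vt (l ++ l') = removeTrusted Vt l ++ removeTrusted Vt l' :=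
  List.filter_append _ _

theorem removeTrusted_eq_nil {l : List V} (h : ∀ x ∈ l, x ∈ Vt) : removeTrusted Vt l = [] := by
  simpa [removeTrusted] using h

theorem removeTrusted_cons_of_notMem {x : V} {l : List V} (h : x ∉ Vt) :
    removeTrusted Vt (x :: l) = x :: removeTrusted Vt l := by
  simp [removeTrusted, h]

theorem claimedSource_eq {path l : List V} {j s : V} (h : path ++ [j] = s :: l) :
    claimedSource path j = s := by
  cases path with
  | nil => exact (List.cons.inj h).1
  | cons a path => exact (List.cons.inj h).1

theorem claimedSource_append (path : List V) (j i : V) :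
    claimedSource (path ++ [j]) i = claimedSource path j := by
  cases path <;> rfl

/-- Disjoint lists have distinct representatives in `C`. This bounds both the disjoint lists
available to a process and the disjoint paths spoilt by `B`. -/
theorem card_le_of_disjoint_of_meets {S : Finset (List V)} {C : Finset V}
    (h : ∀ l ∈ S, ∃ b ∈ C, b ∈ l) (hdisj : ∀ l ∈ S, ∀ l' ∈ S, l ≠ l' → List.Disjoint l l') :
    S.card ≤ C.card := by
  rcases S.eq_empty_or_nonempty with rfl | ⟨l, hl⟩
  · simp
  have : Nonempty V := ⟨(h l hl).choose⟩
  choose! b hb hbl using h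
  refine Finset.card_le_card_of_injOn b hb fun l hl l' hl' e => ?_
  by_contra hne
  exact hdisj l hl l' hl' hne (hbl l hl) (e ▸ hbl l' hl')

/-- A process whose stored lists all meet a set of at most `f` nodes cannot deliver. -/
theorem not_canDeliver {σ : LocalState V M} {s : V} {m : M} (C : Finset V) (hC : C.card ≤ f)
    (h : ∀ l ∈ σ.paths s m, ∃ b ∈ C, b ∈ l) : ¬ CanDeliver f σ s m := by
  rintro ⟨-, h0 | ⟨S, hS, hcard, hdisj⟩⟩
  · obtain ⟨b, -, hb⟩ := h _ h0
    cases hb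
  · have := card_le_of_disjoint_of_meets (fun l hl => h l (hS hl)) hdisj
    omega

/-! ### Routes -/

/-- `Forwards G Vt B s w j`: a payload of `s` travels through the nodes of `w`, then to `j`, by
correct nodes, each of them forwarding it to the next one. -/
inductive Forwards (G : SimpleGraph V) (Vt : Set V) (B : Finset V) (s : V) : List V → V → Prop
  | source : Forwards G Vt B s [] s
  | step {w : List V} {j i : V} (h : Forwards G Vt B s w j) (hadj : G.Adj j i) (hi : i ∉ B)
      (hw : i ∈ Vt ∨ i ∉ w) : Forwards G Vt B s (w ++ [j]) i

/-- Trusted nodes are exempt from the exclusion rule, so they may be visited repeatedly; only an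
untrusted end `y` must be new. -/
theorem Forwards.through_trusted (hB : ∀ b ∈ B, b ∉ Vt) {s y : V} (hy : y ∉ B) (t : List V)
    (ht : ∀ x ∈ t, x ∈ Vt) {w : List V} {x : V} (h : Forwards G Vt B s w x)
    (hc : List.IsChain G.Adj (x :: (t ++ [y]))) (hyw : y ∈ Vt ∨ (y ∉ w ∧ y ≠ x)) :
    Forwards G Vt B s (w ++ x :: t) y := by
  induction t generalizing w x with
  | nil => exact h.step (by simpa using hc) hy (hyw.imp_right And.left)
  | cons a t ih =>
    rw [List.cons_append, List.isChain_cons_cons] at hc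
    have ha : a ∈ Vt := ht a (by simp)
    have := ih (fun z hz => ht z (List.mem_cons_of_mem _ hz))
      (h.step hc.1 (fun hb => hB a hb ha) (Or.inl ha)) hc.2 (by
        by_cases hyt : y ∈ Vt
        · exact Or.inl hyt
        · refine Or.inr ⟨?_, fun hya => hyt (hya ▸ ha)⟩
          simpa using hyw.resolve_left hyt)
    simpa using this

theorem Forwards.of_trustLinked (hB : ∀ b ∈ B, b ∉ Vt) {s y : V} (hy : y ∉ B) {w : List V} {x : V}
    (h : Forwards G Vt B s w x) (hxy : TrustLinked G Vt x y) (hyw : y ∈ Vt ∨ (y ∉ w ∧ y ≠ x)) :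
    ∃ t : List V, (∀ z ∈ t, z ∈ Vt) ∧ Forwards G Vt B s (w ++ x :: t) y := by
  rcases hxy with hxy | ⟨t, -, ht, hc⟩
  · exact ⟨[], by simp, h.through_trusted hB hy [] (by simp) (by simpa using hxy) hyw⟩
  · exact ⟨t, ht, h.through_trusted hB hy t ht hc hyw⟩

/-- Concatenates the trusted detours of successive links. Detours may overlap, but untrusted nodes
do not repeat, so no forwarding is suppressed and filtering leaves exactly `l`. -/
theorem Forwards.along (hB : ∀ b ∈ B, b ∉ Vt) {s i : V} (hi : i ∉ B) (l : List V)
    (hlt : ∀ x ∈ l, x ∉ Vt) (hlB : ∀ x ∈ l, x ∉ B) {w : List V} {x : V}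
    (h : Forwards G Vt B s w x) (hc : List.IsChain (TrustLinked G Vt) (x :: (l ++ [i])))
    (hnodup : (x :: (l ++ [i])).Nodup) (hw : ∀ y ∈ l ++ [i], y ∈ Vt ∨ y ∉ w) :
    ∃ w', Forwards G Vt B s (w ++ x :: w') i ∧ removeTrusted Vt w' = l := by
  induction l generalizing w x with
  | nil =>
    obtain ⟨t, ht, hf⟩ := h.of_trustLinked hB hi (by simpa using hc)
      ((hw i (by simp)).imp_right fun h => ⟨h, fun e => by simp [e] at hnodup⟩)
    exact ⟨t, hf, removeTrusted_eq_nil ht⟩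
  | cons a l ih =>
    rw [List.cons_append, List.isChain_cons_cons] at hc
    have hnd := List.nodup_cons.1 hnodup
    have ha : a ∉ Vt := hlt a (by simp)
    obtain ⟨t, ht, hf⟩ := h.of_trustLinked hB (hlB a (by simp)) hc.1
      ((hw a (by simp)).imp_right fun h => ⟨h, fun e => hnd.1 (by simp [e])⟩)
    obtain ⟨w', hw', hl⟩ := ih (fun z hz => hlt z (List.mem_cons_of_mem _ hz))
      (fun z hz => hlB z (List.mem_cons_of_mem _ hz)) hf hc.2 hnd.2 (by
        intro y hy
        by_cases hyt : y ∈ Vt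
        · exact Or.inl hyt
        refine Or.inr fun hmem => ?_
        rcases List.mem_append.1 hmem with hmem | hmem
        · exact (hw y (List.mem_cons_of_mem _ hy)).elim hyt fun h => h hmem
        · rcases List.mem_cons.1 hmem with rfl | hmem
          · exact hnd.1 (List.mem_cons_of_mem _ hy)
          · exact hyt (ht y hmem))
    refine ⟨t ++ a :: w', by simpa using hw', ?_⟩
    rw [removeTrusted_append, removeTrusted_eq_nil ht, removeTrusted_cons_of_notMem ha, hl,
      List.nil_append]

/-- A process is linked to `s` by trusted nodes only, or by more than `2 f` disjoint paths. -/
def WellLinked (G : SimpleGraph V) (Vt : Set V) (f : ℕ) (s i : V) : Prop :=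
  LinkedVia G Vt s i [] ∨
    ∃ L : Finset (List V), 2 * f < L.card ∧ (∀ l ∈ L, LinkedVia G Vt s i l) ∧
      ∀ l ∈ L, ∀ l' ∈ L, l ≠ l' → List.Disjoint l l'

theorem WellLinked.symm {s i : V} (h : WellLinked G Vt f s i) : WellLinked G Vt f i s := by
  rcases h with h | ⟨L, hcard, hL, hdisj⟩
  · exact Or.inl h.reverse
  · refine Or.inr ⟨L.map ⟨List.reverse, List.reverse_injective⟩, by simpa using hcard, ?_, ?_⟩
    · intro l hl
      obtain ⟨l, hlL, rfl⟩ := Finset.mem_map.1 hl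
      exact (hL l hlL).reverse
    · intro l hl l' hl' hne
      obtain ⟨l, hlL, rfl⟩ := Finset.mem_map.1 hl
      obtain ⟨l', hlL', rfl⟩ := Finset.mem_map.1 hl'
      intro x hx hx'
      exact hdisj l hlL l' hlL' (fun h => hne (h ▸ rfl)) (List.mem_reverse.1 hx)
        (List.mem_reverse.1 hx')

/-- Each Byzantine node spoils at most one of the more than `2 f` disjoint paths, so at least `f +
1` survive. -/
theorem WellLinked.exists_correct {s i : V} (h : WellLinked G Vt f s i) (hf : B.card ≤ f) :
    ∃ L : Finset (List V), (∀ l ∈ L, LinkedVia G Vt s i l ∧ ∀ x ∈ l, x ∉ B) ∧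
      ([] ∈ L ∨ L.card = f + 1 ∧ ∀ l ∈ L, ∀ l' ∈ L, l ≠ l' → List.Disjoint l l') := by
  classical
  rcases h with h | ⟨L, hcard, hL, hdisj⟩
  · exact ⟨{[]}, by simpa using h, Or.inl (by simp)⟩
  · have hbad : (L.filter fun l => ∃ b ∈ B, b ∈ l).card ≤ B.card := by
      refine card_le_of_disjoint_of_meets (fun l hl => (Finset.mem_filter.1 hl).2)
        fun l hl l' hl' => ?_
      exact hdisj l (Finset.mem_filter.1 hl).1 l' (Finset.mem_filter.1 hl').1
    have hsplit := Finset.card_filter_add_card_filter_not (s := L) (fun l => ∃ b ∈ B, b ∈ l)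
    obtain ⟨S, hS, hScard⟩ := Finset.exists_subset_card_eq
      (show f + 1 ≤ (L.filter fun l => ¬ ∃ b ∈ B, b ∈ l).card by omega)
    refine ⟨S, fun l hl => ?_, Or.inr ⟨hScard, fun l hl l' hl' => ?_⟩⟩
    · have := Finset.mem_filter.1 (hS hl)
      exact ⟨hL l this.1, fun x hx hxB => this.2 ⟨x, hxB, hx⟩⟩
    · exact hdisj l (Finset.mem_filter.1 (hS hl)).1 l' (Finset.mem_filter.1 (hS hl')).1

/-! ### Single steps -/

variable [Fintype V]

theorem mem_sendAll {i : V} {excl : List V} {m : M} {path : List V} {p : Packet V M} :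
    p ∈ sendAll G i excl m path ↔ ∃ k, G.Adj i k ∧ k ∉ excl ∧ p = ⟨i, k, m, path⟩ := by
  classical
  simp only [sendAll, Multiset.mem_map, Finset.mem_val, Finset.mem_filter, Finset.mem_univ,
    true_and, and_assoc, eq_comm]



theorem Step.paths_subset {c c' : Config V M} {ev : Event V M} (h : Step G Vt f B c ev c')
    (i s : V) (m : M) : (c.state i).paths s m ⊆ (c'.state i).paths s m := by
  classical
  cases h with
  | broadcast j m' hj =>
    by_cases hij : i = j
    · subst hij
      simp [LocalState.markDelivered]
    · simp [Function.update_of_ne hij]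
  | receive p net' hp hnet =>
    by_cases hij : i = p.dst
    · subst hij
      simp only [Function.update_self, receiveState, LocalState.insertPath]
      exact fun l hl => Or.inl hl
    · simp [Function.update_of_ne hij]
  | faultyReceive p net' hp hnet => rfl
  | deliver j s' m' hj hd =>
    by_cases hij : i = j
    · subst hij
      simp [LocalState.markDelivered]
    · simp [Function.update_of_ne hij]
  | faultySend p hp hadj => rfl
  | idle => rfl

theorem Step.delivered_iff {c c' : Config V M} {ev : Event V M} (h : Step G Vt f B c ev c')
    (i s : V) (m : M) : (c'.state i).delivered s m ↔
      (c.state i).delivered s m ∨ ev = .deliver i s m ∨ (i = s ∧ ev = .broadcast i m) := by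
  classical
  cases h with
  | broadcast j m' hj =>
    by_cases hij : i = j
    · subst hij
      simp [LocalState.markDelivered, eq_comm]
    · simp [Function.update_of_ne hij, Ne.symm hij]
  | receive p net' hp hnet =>
    by_cases hij : i = p.dst
    · subst hij
      simp [receiveState, LocalState.insertPath]
    · simp [Function.update_of_ne hij]
  | faultyReceive p net' hp hnet => simp
  | deliver j s' m' hj hd =>
    by_cases hij : i = j
    · subst hij
      simp [LocalState.markDelivered, eq_comm]
    · simp [Function.update_of_ne hij, Ne.symm hij]
  | faultySend p hp hadj => simp
  | idle => simp

/-- A property `Q` of the messages in transit and a property `T` of the stored lists are preserved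
by a step if they are compatible with sending and with forwarding. -/
theorem Step.preserves {c c' : Config V M} {ev : Event V M} (h : Step G Vt f B c ev c')
    (Q : Packet V M → Prop) (T : V → V → M → List V → Prop)
    (hbroadcast : ∀ i m, ev = .broadcast i m → ∀ k, G.Adj i k → Q ⟨i, k, m, []⟩)
    (hfaulty : ∀ p, ev = .faultySend p → p.src ∈ B → G.Adj p.src p.dst → Q p)
    (hstore : ∀ p, Q p → p.dst ∉ B →
      T p.dst (claimedSource p.path p.src) p.payload (removeTrusted Vt (p.path ++ [p.src]).tail))
    (hforward : ∀ p, Q p → p.dst ∉ B → ∀ k, G.Adj p.dst k →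
      Q ⟨p.dst, k, p.payload, p.path ++ [p.src]⟩)
    (hQ : ∀ p ∈ c.net, Q p) (hT : ∀ i s m, ∀ l ∈ (c.state i).paths s m, T i s m l) :
    (∀ p ∈ c'.net, Q p) ∧ ∀ i s m, ∀ l ∈ (c'.state i).paths s m, T i s m l := by
  classical
  cases h with
  | broadcast j m' hj =>
    constructor
    · intro p hp
      rcases Multiset.mem_add.1 hp with hp | hp
      · exact hQ p hp
      · obtain ⟨k, hk, -, rfl⟩ := mem_sendAll.1 hp
        exact hbroadcast _ _ rfl k hk
    · intro i s m l hl
      by_cases hij : i = j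
      · subst hij
        simp only [Function.update_self, LocalState.markDelivered] at hl
        exact hT _ _ _ _ hl
      · simp only [Function.update_of_ne hij] at hl
        exact hT _ _ _ _ hl
  | receive p net' hp hnet =>
    have hpQ : Q p := hQ p (by rw [hnet]; exact Multiset.mem_cons_self _ _)
    constructor
    · intro q hq
      rcases Multiset.mem_add.1 hq with hq | hq
      · exact hQ q (by rw [hnet]; exact Multiset.mem_cons_of_mem hq)
      · obtain ⟨k, hk, -, rfl⟩ := mem_sendAll.1 hq
        exact hforward p hpQ hp k hk
    · intro i s m l hl
      by_cases hij : i = p.dst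
      · subst hij
        simp only [Function.update_self, receiveState, LocalState.insertPath] at hl
        rcases hl with hl | ⟨rfl, rfl, rfl⟩
        · exact hT _ _ _ _ hl
        · exact hstore p hpQ hp
      · simp only [Function.update_of_ne hij] at hl
        exact hT _ _ _ _ hl
  | faultyReceive p net' hp hnet =>
    exact ⟨fun q hq => hQ q (by rw [hnet]; exact Multiset.mem_cons_of_mem hq), hT⟩
  | deliver j s' m' hj hd =>
    refine ⟨hQ, fun i s m l hl => ?_⟩
    by_cases hij : i = j
    · subst hij
      simp only [Function.update_self, LocalState.markDelivered] at hl
      exact hT _ _ _ _ hl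
    · simp only [Function.update_of_ne hij] at hl
      exact hT _ _ _ _ hl
  | faultySend p hp hadj =>
    refine ⟨fun q hq => ?_, hT⟩
    rcases Multiset.mem_cons.1 hq with rfl | hq
    · exact hfaulty _ rfl hp hadj
    · exact hQ q hq
  | idle => exact ⟨hQ, hT⟩

theorem Step.mem_net_of_broadcast {c c' : Config V M} {i : V} {m : M}
    (h : Step G Vt f B c (.broadcast i m) c') {k : V} (hk : G.Adj i k) :
    ⟨i, k, m, []⟩ ∈ c'.net := by
  cases h
  exact Multiset.mem_add.2 (Or.inr (mem_sendAll.2 ⟨k, hk, by simp, rfl⟩))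

theorem Step.mem_net_of_receive {c c' : Config V M} {p : Packet V M}
    (h : Step G Vt f B c (.receive p) c') (hp : p.dst ∉ B) {k : V} (hk : G.Adj p.dst k)
    (hk' : k ∉ removeTrusted Vt (p.path ++ [p.src])) :
    ⟨p.dst, k, p.payload, p.path ++ [p.src]⟩ ∈ c'.net := by
  cases h with
  | receive => exact Multiset.mem_add.2 (Or.inr (mem_sendAll.2 ⟨k, hk, hk', rfl⟩))
  | faultyReceive _ _ hp' => exact absurd hp' hp

theorem Step.mem_paths_of_receive {c c' : Config V M} {p : Packet V M}
    (h : Step G Vt f B c (.receive p) c') (hp : p.dst ∉ B) :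
    removeTrusted Vt (p.path ++ [p.src]).tail ∈
      (c'.state p.dst).paths (claimedSource p.path p.src) p.payload := by
  cases h with
  | receive => simp [receiveState, LocalState.insertPath]
  | faultyReceive _ _ hp' => exact absurd hp' hp

theorem Step.canDeliver {c c' : Config V M} {i s : V} {m : M}
    (h : Step G Vt f B c (.deliver i s m) c') : CanDeliver f (c.state i) s m := by
  cases h
  assumption

/-! ### Safety -/

theorem Execution.delivered_iff (e : Execution M G Vt f B) (n : ℕ) (i s : V) (m : M) :
    ((e.config n).state i).delivered s m ↔ ∃ k < n, e.DeliversAt k i s m := by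
  induction n with
  | zero => simp [e.init, initState]
  | succ n ih =>
    rw [(e.step n).delivered_iff, ih]
    constructor
    · rintro (⟨k, hk, h⟩ | h)
      · exact ⟨k, by omega, h⟩
      · exact ⟨n, by omega, h⟩
    · rintro ⟨k, hk, h⟩
      rcases Nat.lt_succ_iff_lt_or_eq.1 hk with hk | rfl
      · exact Or.inl ⟨k, hk, h⟩
      · exact Or.inr h

theorem paths_mono_of_steps {c : ℕ → Config V M} {ev : ℕ → Event V M}
    (h : ∀ n, Step G Vt f B (c n) (ev n) (c (n + 1))) {n k : ℕ} (hnk : n ≤ k) (i s : V) (m : M) :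
    ((c n).state i).paths s m ⊆ ((c k).state i).paths s m := by
  induction k, hnk using Nat.le_induction with
  | base => rfl
  | succ k _ ih => exact ih.trans ((h k).paths_subset i s m)

/-- As long as a correct process has not broadcast a payload, the lists stored for this payload
contain Byzantine nodes. -/
theorem Execution.paths_forged (e : Execution M G Vt f B) (hB : ∀ b ∈ B, b ∉ Vt) {s : V}
    (hs : s ∉ B) (m : M) (n : ℕ) (hn : ∀ k < n, e.event k ≠ .broadcast s m) (i : V) :
    ∀ l ∈ ((e.config n).state i).paths s m, ∃ b ∈ B, b ∈ l := by
  have key : (∀ p ∈ (e.config n).net, p.payload = m → claimedSource p.path p.src = s →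
        ∃ b ∈ B, b ∈ (p.path ++ [p.src]).tail) ∧
      ∀ i s' m', ∀ l ∈ ((e.config n).state i).paths s' m', s' = s → m' = m →
        ∃ b ∈ B, b ∈ l := by
    induction n with
    | zero => simp [e.init, initState]
    | succ n ih =>
      obtain ⟨h1, h2⟩ := ih fun k hk => hn k (by omega)
      refine (e.step n).preserves
        (fun p => p.payload = m → claimedSource p.path p.src = s →
          ∃ b ∈ B, b ∈ (p.path ++ [p.src]).tail)
        (fun _ s' m' l => s' = s → m' = m → ∃ b ∈ B, b ∈ l) ?_ ?_ ?_ ?_ h1 h2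
      · rintro i m' he k - rfl rfl
        exact absurd he (hn n (by omega))
      · rintro ⟨src, dst, m', path⟩ - hp - rfl h
        -- An empty path names the Byzantine sender itself as source, which is not `s`; otherwise
        -- the sender lies in the tail.
        cases path with
        | nil => exact absurd (h ▸ hp : s ∈ B) hs
        | cons a path => exact ⟨src, hp, by simp⟩
      · intro p hp _ h1 h2
        obtain ⟨b, hb, hbl⟩ := hp h2 h1
        exact ⟨b, hb, mem_removeTrusted.2 ⟨hbl, hB b hb⟩⟩
      · intro p hp _ k _ h1 h2
        obtain ⟨b, hb, hbl⟩ := hp h1 ((claimedSource_append _ _ _).symm.trans h2)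
        refine ⟨b, hb, ?_⟩
        rw [List.tail_append_of_ne_nil (by simp)]
        exact List.mem_append_left _ hbl
  exact fun l hl => key.2 i s m l hl rfl rfl

theorem Execution.no_creation (e : Execution M G Vt f B) (hB : ∀ b ∈ B, b ∉ Vt) (hf : B.card ≤ f)
    {s : V} (hs : s ∉ B) (i : V) (m : M) (n : ℕ) (h : e.DeliversAt n i s m) :
    ∃ k, k ≤ n ∧ e.event k = .broadcast s m := by
  rcases h with h | ⟨rfl, h⟩
  · by_contra hn
    push Not at hn
    have hd := e.step n
    rw [h] at hd
    exact not_canDeliver B hf (e.paths_forged hB hs m n (fun k hk => hn k hk.le) i) hd.canDeliver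
  · exact ⟨n, le_rfl, h⟩

theorem Execution.no_duplication (e : Execution M G Vt f B) (hB : ∀ b ∈ B, b ∉ Vt)
    (hf : B.card ≤ f) {s : V} (hs : s ∉ B) (i : V) (m : M) (n k : ℕ) (hn : e.DeliversAt n i s m)
    (hk : e.DeliversAt k i s m) : n = k := by
  have key : ∀ n k, e.DeliversAt n i s m → e.DeliversAt k i s m → ¬ n < k := by
    rintro n k hn hk hlt
    rcases hk with hk | ⟨rfl, hb⟩
    · have hd := e.step k
      rw [hk] at hd
      exact hd.canDeliver.1 ((e.delivered_iff k i s m).2 ⟨n, hlt, hn⟩)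
    -- An own broadcast after a delivery would be a second broadcast, since the earlier delivery
    -- already required one.
    · obtain ⟨j, hj, hj'⟩ := e.no_creation hB hf hs _ m n hn
      have := e.broadcast_once _ _ _ _ hb hj'
      omega
  exact le_antisymm (not_lt.1 (key k n hk hn)) (not_lt.1 (key n k hn hk))

theorem Execution.deliversAt_of_delivered (e : Execution M G Vt f B) (hB : ∀ b ∈ B, b ∉ Vt)
    (hf : B.card ≤ f) {s i : V} (hs : s ∉ B) {m : M} {n k : ℕ} (hn : e.event n = .broadcast s m)
    (hk : ((e.config k).state i).delivered s m) : ∃ j, n ≤ j ∧ e.DeliversAt j i s m := by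
  obtain ⟨j, -, hj⟩ := (e.delivered_iff k i s m).1 hk
  obtain ⟨j', hj', h⟩ := e.no_creation hB hf hs i m j hj
  obtain rfl := e.broadcast_once _ _ _ _ hn h
  exact ⟨j, hj', hj⟩

/-! ### Liveness -/

theorem Execution.exists_sent (e : Execution M G Vt f B) {s : V} {m : M} {n : ℕ}
    (hn : e.event n = .broadcast s m) {w : List V} {j : V} (h : Forwards G Vt B s w j) :
    ∃ k, (∀ i, G.Adj j i → i ∉ removeTrusted Vt w → ⟨j, i, m, w⟩ ∈ (e.config k).net) ∧
      ∀ w', w = s :: w' → removeTrusted Vt w' ∈ ((e.config k).state j).paths s m := by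
  induction h with
  | source =>
    have hs := e.step n
    rw [hn] at hs
    exact ⟨n + 1, fun i hi _ => hs.mem_net_of_broadcast hi, by simp⟩
  | @step w j i h hadj hi hw ih =>
    obtain ⟨k, hk, -⟩ := ih
    have hiw : i ∉ removeTrusted Vt w := fun hmem => by
      rw [mem_removeTrusted] at hmem
      exact hw.elim hmem.2 fun h => h hmem.1
    obtain ⟨k', -, hk'⟩ := e.fair_net k _ (hk i hadj hiw) hi
    have hs := e.step k'
    rw [hk'] at hs
    refine ⟨k' + 1, fun x hx hx' => hs.mem_net_of_receive hi hx hx', fun w' hw' => ?_⟩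
    have := hs.mem_paths_of_receive hi
    rwa [claimedSource_eq hw', hw', List.tail_cons] at this

/-- The correct untrusted paths of `f(G)` are eventually stored at the destination. -/
theorem Execution.exists_mem_paths (e : Execution M G Vt f B) (hB : ∀ b ∈ B, b ∉ Vt) {s i : V}
    (hi : i ∉ B) {m : M} {n : ℕ} (hn : e.event n = .broadcast s m) {l : List V}
    (hl : LinkedVia G Vt s i l) (hlB : ∀ x ∈ l, x ∉ B) :
    ∃ k, l ∈ ((e.config k).state i).paths s m := by
  obtain ⟨w, hw, rfl⟩ := Forwards.source.along hB hi l hl.untrusted hlB hl.chain hl.nodup (by simp)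
  obtain ⟨k, -, hk⟩ := e.exists_sent hn hw
  exact ⟨k, hk w (by simp)⟩

theorem Execution.validity (e : Execution M G Vt f B) (hB : ∀ b ∈ B, b ∉ Vt) (hf : B.card ≤ f)
    {s i : V} (hs : s ∉ B) (hi : i ∉ B) (h : WellLinked G Vt f s i) (m : M) (n : ℕ)
    (hn : e.event n = .broadcast s m) : ∃ k, n ≤ k ∧ e.DeliversAt k i s m := by
  obtain ⟨L, hL, hdel⟩ := h.exists_correct hf
  have hmem : ∀ l ∈ L, ∃ k, l ∈ ((e.config k).state i).paths s m := fun l hl =>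
    e.exists_mem_paths hB hi hn (hL l hl).1 (hL l hl).2
  choose! k hk using hmem
  -- Stored lists are never removed, so all of `L` is present at the latest of the storage times.
  have hsub : ∀ l ∈ L, l ∈ ((e.config (L.sup k)).state i).paths s m := fun l hl =>
    paths_mono_of_steps e.step (Finset.le_sup hl) i s m (hk l hl)
  by_cases hd : ((e.config (L.sup k)).state i).delivered s m
  · exact e.deliversAt_of_delivered hB hf hs hn hd
  · have hcan : CanDeliver f ((e.config (L.sup k)).state i) s m :=
      ⟨hd, hdel.imp (hsub _) fun ⟨hc, hdisj⟩ => ⟨L, hsub, hc, hdisj⟩⟩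
    obtain ⟨k', -, hk'⟩ := e.fair_deliver _ i s m hi hcan
    exact e.deliversAt_of_delivered hB hf hs hn hk'

theorem Execution.reliable_of_wellLinked (e : Execution M G Vt f B) (hB : ∀ b ∈ B, b ∉ Vt)
    (hf : B.card ≤ f) {s i : V} (hs : s ∉ B) (hi : i ∉ B) (h : s = i ∨ WellLinked G Vt f s i) :
    e.Reliable s i where
  no_duplication := e.no_duplication hB hf hs i
  no_creation := e.no_creation hB hf hs i
  validity m n hn := by
    rcases h with rfl | h
    · exact ⟨n, le_rfl, Or.inr ⟨rfl, hn⟩⟩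
    · exact e.validity hB hf hs hi h m n hn

/-! ### Fair executions -/

/-- Enumerating pairs and forgetting the second component repeats every element at arbitrarily late
times. -/
theorem exists_fair_enumeration (T : Type*) [Countable T] [Nonempty T] :
    ∃ turn : ℕ → T, ∀ t n, ∃ k, n ≤ k ∧ turn k = t := by
  obtain ⟨g, hg⟩ := exists_surjective_nat T
  refine ⟨fun k => g k.unpair.1, fun t n => ?_⟩
  obtain ⟨a, rfl⟩ := hg t
  exact ⟨Nat.pair a n, Nat.right_le_pair a n, by simp⟩

theorem Step.mem_net_of_ne {c c' : Config V M} {ev : Event V M} (h : Step G Vt f B c ev c')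
    {p : Packet V M} (hp : p ∈ c.net) (hev : ev ≠ .receive p) : p ∈ c'.net := by
  have aux : ∀ (q : Packet V M) (net' : Multiset (Packet V M)), Event.receive q ≠ .receive p →
      c.net = q ::ₘ net' → p ∈ net' := by
    intro q net' hq hnet
    rw [hnet] at hp
    rcases Multiset.mem_cons.1 hp with rfl | hp
    · exact absurd rfl hq
    · exact hp
  cases h with
  | broadcast => exact Multiset.mem_add.2 (Or.inl hp)
  | receive q net' _ hnet => exact Multiset.mem_add.2 (Or.inl (aux q net' hev hnet))
  | faultyReceive q net' _ hnet => exact aux q net' hev hnet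
  | deliver => exact hp
  | faultySend => exact Multiset.mem_cons_of_mem hp
  | idle => exact hp

theorem exists_step_receive (c : Config V M) {p : Packet V M} (hp : p ∈ c.net) (hB : p.dst ∉ B) :
    ∃ c', Step G Vt f B c (.receive p) c' := by
  obtain ⟨net', hnet⟩ := Multiset.exists_cons_of_mem hp
  exact ⟨_, Step.receive c p net' hB hnet⟩

open Classical in
/-- The scheduled event if it is possible, and nothing otherwise. -/
noncomputable def attemptEvent (G : SimpleGraph V) (Vt : Set V) (f : ℕ) (B : Finset V)
    (c : Config V M) (ev : Event V M) : Event V M :=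
  if ∃ c', Step G Vt f B c ev c' then ev else .idle

theorem exists_step_attemptEvent (c : Config V M) (ev : Event V M) :
    ∃ c', Step G Vt f B c (attemptEvent G Vt f B c ev) c' := by
  unfold attemptEvent
  split_ifs with h
  · exact h
  · exact ⟨c, Step.idle c⟩

theorem attemptEvent_eq_or (c : Config V M) (ev : Event V M) :
    attemptEvent G Vt f B c ev = ev ∨ attemptEvent G Vt f B c ev = .idle := by
  unfold attemptEvent
  split_ifs
  · exact Or.inl rfl
  · exact Or.inr rfl

theorem attemptEvent_eq {c : Config V M} {ev : Event V M} (h : ∃ c', Step G Vt f B c ev c') :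
    attemptEvent G Vt f B c ev = ev :=
  if_pos h

/-- The configurations reached when the given events are attempted one after the other. -/
noncomputable def runConfig (G : SimpleGraph V) (Vt : Set V) (f : ℕ) (B : Finset V)
    (ev : ℕ → Event V M) : ℕ → Config V M
  | 0 => ⟨fun _ => initState V M, 0⟩
  | n + 1 => (exists_step_attemptEvent (G := G) (Vt := Vt) (f := f) (B := B)
      (runConfig G Vt f B ev n) (ev n)).choose

theorem runConfig_step (ev : ℕ → Event V M) (n : ℕ) :
    Step G Vt f B (runConfig G Vt f B ev n) (attemptEvent G Vt f B (runConfig G Vt f B ev n) (ev n))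
      (runConfig G Vt f B ev (n + 1)) :=
  (exists_step_attemptEvent (runConfig G Vt f B ev n) (ev n)).choose_spec

/-- There is a fair execution in which the only broadcast is that of `m` by `s`, at time `0`, and in
which the Byzantine processes remain silent. -/
theorem exists_silent_execution (G : SimpleGraph V) (Vt : Set V) (f : ℕ) (B : Finset V) {s : V}
    (hs : s ∉ B) (m : M) :
    ∃ e : Execution M G Vt f B, e.event 0 = .broadcast s m ∧
      (∀ n i m', e.event n = .broadcast i m' → i = s) ∧ ∀ n p, e.event n ≠ .faultySend p := by
  have : Nonempty V := ⟨s⟩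
  -- Only events about `m` are scheduled, so the schedule is countable even when `M` is not; `hinv`
  -- shows that no other payload ever occurs.
  obtain ⟨turn, hturn⟩ := exists_fair_enumeration ((V × V × List V) ⊕ (V × V))
  let toEvent : (V × V × List V) ⊕ (V × V) → Event V M :=
    Sum.elim (fun t => .receive ⟨t.1, t.2.1, m, t.2.2⟩) (fun t => .deliver t.1 t.2 m)
  let ev : ℕ → Event V M := fun n => Nat.casesOn n (.broadcast s m) fun n => toEvent (turn n)
  have hev : ∀ t n, ∃ k, n ≤ k ∧ ev k = toEvent t := fun t n => by
    obtain ⟨k, hk, h⟩ := hturn t n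
    exact ⟨k + 1, by omega, by simp only [ev, h]⟩
  have hevb : ∀ n i m', ev n = .broadcast i m' → n = 0 ∧ i = s ∧ m' = m := by
    intro n i m' h
    cases n with
    | zero =>
      cases h
      exact ⟨rfl, rfl, rfl⟩
    | succ n =>
      replace h : toEvent (turn n) = _ := h
      generalize turn n = t at h
      rcases t with t | t <;> cases h
  have hevf : ∀ n p, ev n ≠ .faultySend p := by
    intro n p h
    cases n with
    | zero => cases h
    | succ n =>
      replace h : toEvent (turn n) = _ := h
      generalize turn n = t at h
      rcases t with t | t <;> cases h
  let c := runConfig G Vt f B ev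
  let ev' : ℕ → Event V M := fun n => attemptEvent G Vt f B (c n) (ev n)
  have hstep : ∀ n, Step G Vt f B (c n) (ev' n) (c (n + 1)) := runConfig_step ev
  have hb : ∀ n i m', ev' n = .broadcast i m' → n = 0 ∧ i = s ∧ m' = m := by
    intro n i m' h
    rcases attemptEvent_eq_or (G := G) (Vt := Vt) (f := f) (B := B) (c n) (ev n) with h' | h'
    · exact hevb n i m' (h'.symm.trans h)
    · cases h'.symm.trans h
  have hf : ∀ n p, ev' n ≠ .faultySend p := by
    intro n p h
    rcases attemptEvent_eq_or (G := G) (Vt := Vt) (f := f) (B := B) (c n) (ev n) with h' | h'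
    · exact hevf n p (h'.symm.trans h)
    · cases h'.symm.trans h
  have hinv : ∀ n, (∀ p ∈ (c n).net, p.payload = m) ∧
      ∀ i s' m', ∀ l ∈ ((c n).state i).paths s' m', m' = m := by
    intro n
    induction n with
    | zero => simp [c, runConfig, initState]
    | succ n ih =>
      exact (hstep n).preserves (fun p => p.payload = m) (fun _ _ m' _ => m' = m)
        (fun i m' h _ _ => (hb n i m' h).2.2) (fun p h => absurd h (hf n p))
        (fun p h _ => h) (fun p h _ _ _ => h) ih.1 ih.2
  refine ⟨⟨c, ev', rfl, hstep, ?_, ?_, ?_⟩, ?_, fun n i m' h => (hb n i m' h).2.1, hf⟩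
  · intro n k i m' hn hk
    rw [(hb n i m' hn).1, (hb k i m' hk).1]
  · intro n p hp hpB
    obtain ⟨k, hk, hek⟩ := hev (.inl (p.src, p.dst, p.path)) n
    replace hek : ev k = .receive p := by
      rw [hek]
      simp only [toEvent, Sum.elim_inl, ← (hinv n).1 p hp]
    by_contra hno
    push Not at hno
    -- A message never received stays in transit until its turn, when its reception is possible and
    -- hence happens.
    have hmem : ∀ j, n ≤ j → p ∈ (c j).net := by
      intro j hj
      induction j, hj using Nat.le_induction with
      | base => exact hp
      | succ j hj ih => exact (hstep j).mem_net_of_ne ih (hno j hj)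
    refine hno k hk ?_
    simp only [ev', hek]
    exact attemptEvent_eq (exists_step_receive _ (hmem k hk) hpB)
  · intro n i s' m' hi hcan
    obtain rfl : m' = m := by
      rcases hcan.2 with h | ⟨S, hS, hcard, -⟩
      · exact (hinv n).2 i s' m' _ h
      · obtain ⟨l, hl⟩ := Finset.card_pos.1 (by omega : 0 < S.card)
        exact (hinv n).2 i s' m' l (hS hl)
    obtain ⟨k, hk, hek⟩ := hev (.inr (i, s')) n
    by_cases hd : ((c k).state i).delivered s' m'
    · exact ⟨k, hk, hd⟩
    have hsub := paths_mono_of_steps hstep hk i s' m'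
    have hcan' : CanDeliver f ((c k).state i) s' m' :=
      ⟨hd, hcan.2.imp (fun h => hsub h) fun ⟨S, hS, h⟩ => ⟨S, hS.trans hsub, h⟩⟩
    refine ⟨k + 1, by omega, ((hstep k).delivered_iff i s' m').2 (Or.inr (Or.inl ?_))⟩
    simp only [ev', hek]
    exact attemptEvent_eq ⟨_, Step.deliver _ i s' m' hi hcan'⟩
  · exact attemptEvent_eq ⟨_, Step.broadcast _ s m hs⟩

/-! ### Necessity -/

/-- If `2 f` untrusted nodes separate `u` from `v`, the two nodes cannot communicate reliably. -/
theorem not_communicateReliably_of_separator [Nonempty M] (G : SimpleGraph V) (Vt : Set V) (f : ℕ)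
    {u v : V} (hu : u ∈ Vt) (D : Set V) (X : Finset V) (hcard : X.card ≤ 2 * f)
    (hXt : ∀ x ∈ X, x ∉ Vt) (huD : u ∈ D) (hvD : v ∉ D) (hvX : v ∉ X)
    (hsep : ∀ x ∈ D, ∀ y, G.Adj x y → y ∈ D ∨ y ∈ X) : ¬ CommunicateReliably M G Vt f u v := by
  classical
  intro hrel
  obtain ⟨m⟩ := ‹Nonempty M›
  -- `B` has `min f X.card` elements, so both `B` and `X \ B` have at most `f`.
  obtain ⟨B, hBX, hB⟩ := Finset.exists_subset_card_eq (min_le_right f X.card)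
  have hC : (X \ B).card ≤ f := by
    rw [Finset.card_sdiff_of_subset hBX]
    omega
  have huB : u ∉ B := fun h => hXt u (hBX h) hu
  obtain ⟨e, he0, heb, hef⟩ := exists_silent_execution G Vt f B huB m
  -- A message still sent from within `D` cannot be addressed to `v`. To leave `D` it must enter
  -- `X`: nodes of `B` swallow it, and nodes of `X \ B` are recorded on its path when they forward
  -- it.
  have hinv : ∀ n, (∀ p ∈ (e.config n).net, G.Adj p.src p.dst ∧
        ((∃ x ∈ X \ B, x ∈ (p.path ++ [p.src]).tail) ∨ p.src ∈ D)) ∧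
      ∀ i s' m', ∀ l ∈ ((e.config n).state i).paths s' m', i = v → ∃ x ∈ X \ B, x ∈ l := by
    intro n
    induction n with
    | zero => simp [e.init, initState]
    | succ n ih =>
      refine (e.step n).preserves
        (fun p => G.Adj p.src p.dst ∧ ((∃ x ∈ X \ B, x ∈ (p.path ++ [p.src]).tail) ∨ p.src ∈ D))
        (fun i _ _ l => i = v → ∃ x ∈ X \ B, x ∈ l) ?_ ?_ ?_ ?_ ih.1 ih.2
      · intro i m' h k hk
        obtain rfl := heb n i m' h
        exact ⟨hk, Or.inr huD⟩
      · exact fun p h => absurd h (hef n p)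
      · rintro p ⟨hadj, ⟨x, hx, hxp⟩ | hD⟩ - hpv
        · exact ⟨x, hx, mem_removeTrusted.2 ⟨hxp, hXt x (Finset.mem_sdiff.1 hx).1⟩⟩
        · rcases hsep _ hD _ hadj with h | h
          · exact absurd (hpv ▸ h) hvD
          · exact absurd (hpv ▸ h) hvX
      · rintro p ⟨hadj, h⟩ hpB k hk
        refine ⟨hk, ?_⟩
        dsimp only
        rw [List.tail_append_of_ne_nil (by simp)]
        rcases h with ⟨x, hx, hxp⟩ | hD
        · exact Or.inl ⟨x, hx, List.mem_append_left _ hxp⟩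
        · rcases hsep _ hD _ hadj with h | h
          · exact Or.inr h
          · exact Or.inl ⟨p.dst, Finset.mem_sdiff.2 ⟨h, hpB⟩, by simp⟩
  obtain ⟨k, -, hk | ⟨rfl, -⟩⟩ := (hrel B (fun b hb => hXt b (hBX hb))
    (hB.trans_le (min_le_left _ _)) huB (fun h => hvX (hBX h)) e u v (Or.inl rfl)
    (Or.inr rfl)).validity m 0 he0
  · have hs := e.step k
    rw [hk] at hs
    exact not_canDeliver (X \ B) hC (fun l hl => (hinv k).2 v u m l hl rfl) hs.canDeliver
  · exact hvD huD

/-! ### Sufficiency -/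

theorem communicateReliably_of_wellLinked (M : Type*) (G : SimpleGraph V) (Vt : Set V) (f : ℕ)
    {u v : V} (h : WellLinked G Vt f u v) : CommunicateReliably M G Vt f u v := by
  rintro B hB hf hu hv e s i (rfl | rfl) (rfl | rfl)
  · exact e.reliable_of_wellLinked hB hf hu hu (Or.inl rfl)
  · exact e.reliable_of_wellLinked hB hf hu hv (Or.inr h)
  · exact e.reliable_of_wellLinked hB hf hv hu (Or.inr h.symm)
  · exact e.reliable_of_wellLinked hB hf hv hv (Or.inl rfl)

end DolevUT

/-! ### The characterisation -/

theorem mainTheorem4 {V M : Type*} [Fintype V] [Nonempty M] (G : SimpleGraph V) (Vt : Set V)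
    (f : ℕ) (ut v : V) (hut : ut ∈ Vt) (hv : v ∉ Vt) :
    DolevUT.CommunicateReliably M G Vt f ut v ↔
      ut ∈ (insertNode G Vt (untrustedGraph G Vt) ut).neighborSet v ∨
        ((2 * f + 1 : ℕ) : ℕ∞) ≤
          vertexConnectivity (insertNode G Vt (untrustedGraph G Vt) ut) ut v := by
  have hne : ut ≠ v := fun h => hv (h ▸ hut)
  constructor
  · intro hrel
    by_contra hno
    rw [not_or] at hno
    obtain ⟨D, X, hcard, hXt, huD, hvD, hvX, hsep⟩ :=
      exists_untrusted_separator G Vt hut hv (fun h => hno.1 h.symm) hno.2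
    exact DolevUT.not_communicateReliably_of_separator G Vt f hut D X hcard hXt huD hvD hvX hsep
      hrel
  · intro h
    refine DolevUT.communicateReliably_of_wellLinked M G Vt f ?_
    rcases h with h | h
    · exact Or.inl ⟨by simpa using (insertNode_adj_trustLinked h).symm, by simpa using hne,
        by simp⟩
    · exact Or.inr (exists_disjoint_linkedVia G Vt hne h)
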